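/- A deterministic object type $T$ consists of a set of states, a set of operations and a set of responses, together with functions that assign to every state $q$ and operation $op$ a unique next state and a unique response. (No operation that reads the state is required to exist.) For operations $op_1,\dots,op_m$, a state $q_0$ and $X\subseteq\{1,\dots,m\}$, let $Q_X(q_0,op_1,\dots,op_m)$ be the set of states $q$ for which there are distinct indices $i_1,\dots,i_\alpha\in\{1,\dots,m\}$, $\alpha\ge 1$, with $i_1\in X$ such that applying $op_{i_1},\dots,op_{i_\alpha}$ in this order to an object of type $T$ in state $q_0$ leaves it in state $q$. The type $T$ is called $m$-recording if there exist a state $q_0$, a partition of $\{1,\dots,m\}$ into two non-empty sets $A$ and $B$, and operations $op_1,\dots,op_m$ such that (1) $Q_A\cap Q_B=\emptyset$; (2) $q_0\notin Q_A$ or $|B|=1$; (3) $q_0\notin Q_B$ or $|A|=1$ (where $Q_X=Q_X(q_0,op_1,\dots,op_m)$). Consider an asynchronous system of $n$ deterministic processes that communicate by atomic operations on shared objects of type $T$ and on read/write registers (possibly infinitely many of each, with arbitrary initial states). In an execution, at each point one process takes the next step of its code or one process crashes; processes crash individually, at any time and any number of times. A crash leaves the shared memory unchanged and resets the local state of the process,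 which then starts its code again from the beginning with the same input. An algorithm solves recoverable consensus (RC) among the $n$ processes, for inputs from a set $V$ with at least two elements, if for every assignment of inputs in $V$ and every execution: (Agreement) no two output values produced are different, including outputs of different processes and outputs of the same process in different runs of its code; (Validity) each output value is the input value of some process; (Recoverable wait-freedom) a process that executes its code from the beginning either crashes or outputs a value after a finite number of its own steps. **Theorem.** Let $n\ge 3$ and let $T$ be a deterministic object type. If there is an algorithm that uses objects of type $T$ and registers and solves recoverable consensus among $n$ processes, then $T$ is $(n-1)$-recording. -/

import Mathlib

open Filter

universe uS uO uR uV uX uG uD uL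

/-- A deterministic shared object type: a sequential specification that assigns to every state and
every operation (its name together with its arguments) a unique next state and a unique response.
No read operation is required. -/
structure ObjectType where
  State : Type uS
  Op : Type uO
  Resp : Type uR
  nextState : State → Op → State
  response : State → Op → Resp

namespace ObjectType

variable (T : ObjectType.{uS, uO, uR})

/-- The state of an object after a sequence of operations has been applied to it, from left to
right, starting in state `q`. -/
def applySeq (q : T.State) (l : List T.Op) : T.State :=
  l.foldl T.nextState q

/-- The set `Q_X(q₀, op₁, …, op_m)`: all states in which an object initially in state `q₀` can be
left by a non-empty sequence `op_{i₁}, …, op_{i_α}` with distinct indices and `i₁ ∈ X`. -/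
def Q {m : ℕ} (X : Finset (Fin m)) (q₀ : T.State) (op : Fin m → T.Op) : Set T.State :=
  {q | ∃ i ∈ X, ∃ l : List (Fin m), (i :: l).Nodup ∧ T.applySeq q₀ ((i :: l).map op) = q}

/-- The type `T` is `m`-recording. -/
def IsRecording (m : ℕ) : Prop :=
  ∃ (q₀ : T.State) (A B : Finset (Fin m)) (op : Fin m → T.Op),
    A.Nonempty ∧ B.Nonempty ∧ Disjoint A B ∧ A ∪ B = Finset.univ ∧
    T.Q A q₀ op ∩ T.Q B q₀ op = ∅ ∧
    (q₀ ∉ T.Q A q₀ op ∨ B.card = 1) ∧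
    (q₀ ∉ T.Q B q₀ op ∨ A.card = 1)

end ObjectType

/-- What the code of a process does next, given its local state: apply an operation to
one of the objects of type `T`, read a register, write a register (each one atomic step on shared
memory, after which the local state is the one given by the last argument, which may depend on the
response), or return an output value. -/
inductive CodeStep (T : ObjectType.{uS, uO, uR}) (V : Type uV) (Obj : Type uX) (Reg : Type uG)
    (Val : Type uD) (Loc : Type uL)
  | access (o : Obj) (a : T.Op) (k : T.Resp → Loc)
  | read (r : Reg) (k : Val → Loc)
  | write (r : Reg) (x : Val) (k : Loc)
  | output (v : V)

/-- A deterministic algorithm for `n` processes with inputs and outputs in `V` that uses objects of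
type `T` and read/write registers. There may be infinitely many of both, and each has its own
initial state, chosen by the algorithm. -/
structure Algorithm (T : ObjectType.{uS, uO, uR}) (n : ℕ) (V : Type uV) where
  /-- the names of the objects of type `T` -/
  Obj : Type uX
  /-- the names of the registers -/
  Reg : Type uG
  /-- the values that a register can store -/
  Val : Type uD
  /-- the local states (volatile memory and programme counter) -/
  Loc : Type uL
  objInit : Obj → T.State
  regInit : Reg → Val
  /-- the local state in which a process with a given input begins each run of its code -/
  start : Fin n → V → Loc
  /-- the code of each process -/
  code : Fin n → Loc → CodeStep T V Obj Reg Val Loc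

/-- The events of an execution of `n` processes with independent crashes: one process performs the
next step of its code, or one process crashes (and recovers). -/
inductive Event (n : ℕ)
  | step (p : Fin n)
  | crash (p : Fin n)

namespace Algorithm

variable {T : ObjectType.{uS, uO, uR}} {n : ℕ} {V : Type uV}
variable (A : Algorithm.{uS, uO, uR, uV, uX, uG, uD, uL} T n V)

/-- A configuration: the states of all (non-volatile) shared objects and registers, and the local
states of all processes. -/
structure Config where
  obj : A.Obj → T.State
  reg : A.Reg → A.Val
  loc : Fin n → A.Loc

/-- The initial configuration. -/
def initial (input : Fin n → V) : A.Config where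
  obj := A.objInit
  reg := A.regInit
  loc := fun p => A.start p (input p)

open Classical in
/-- The effect of one event. A process that has returned an output takes no further steps
(scheduling it has no effect) unless it crashes. A crash leaves shared memory unchanged and resets
the local state of the process, which then begins its code again with the same input. -/
noncomputable def exec (input : Fin n → V) (c : A.Config) : Event n → A.Config
  | .step p =>
    match A.code p (c.loc p) with
    | .access o a k =>
      { c with
        obj := Function.update c.obj o (T.nextState (c.obj o) a)
        loc := Function.update c.loc p (k (T.response (c.obj o) a)) }
    | .read r k => { c with loc := Function.update c.loc p (k (c.reg r)) }
    | .write r x k =>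
      { c with
        reg := Function.update c.reg r x
        loc := Function.update c.loc p k }
    | .output _ => c
  | .crash p => { c with loc := Function.update c.loc p (A.start p (input p)) }

/-- The configuration after the first `t` events of the execution with inputs `input` and
schedule `σ`. Schedules are arbitrary; the finite executions are the prefixes. -/
noncomputable def config (input : Fin n → V) (σ : ℕ → Event n) : ℕ → A.Config
  | 0 => A.initial input
  | t + 1 => A.exec input (config input σ t) (σ t)

/-- In the execution with inputs `input` and schedule `σ`, process `p` is, after `t` events, at the
end of a run of its code in which it outputs `v`. -/
def Outputs (input : Fin n → V) (σ : ℕ → Event n) (t : ℕ) (p : Fin n) (v : V) : Prop :=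
  A.code p ((A.config input σ t).loc p) = .output v

/-- No two output values produced in an execution are different, be they outputs of different
processes or of different runs of one process. -/
def Agreement : Prop :=
  ∀ (input : Fin n → V) (σ : ℕ → Event n) (s t : ℕ) (p q : Fin n) (v w : V),
    A.Outputs input σ s p v → A.Outputs input σ t q w → v = w

/-- Each output value is the input value of some process. -/
def Validity : Prop :=
  ∀ (input : Fin n → V) (σ : ℕ → Event n) (t : ℕ) (p : Fin n) (v : V),
    A.Outputs input σ t p v → ∃ q, input q = v

/-- A process that keeps taking steps and does not crash any more outputs a value after finitely
many of its own steps, whatever the other processes do and however often they crash. -/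
def RecoverableWaitFree : Prop :=
  ∀ (input : Fin n → V) (σ : ℕ → Event n) (p : Fin n) (t : ℕ),
    (∀ s ≥ t, σ s ≠ .crash p) → (∃ᶠ s in atTop, σ s = .step p) →
      ∃ s ≥ t, ∃ v, A.Outputs input σ s p v

/-- The algorithm solves recoverable consensus with independent crashes. -/
def SolvesRC : Prop :=
  A.Agreement ∧ A.Validity ∧ A.RecoverableWaitFree

end Algorithm

/-! A valency argument in which a single process `z` may crash, and only within a budget: a crash
costs one credit, and each step of another process earns one. In an infinite allowed schedule either
some other process, which never crashes, takes infinitely many steps, or the credits bound the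
remaining crashes and `z` finally runs undisturbed. Wait-freedom thus forces an output, and a
critical configuration exists (`exists_critical`). There the first process `p` to move fixes the
decision `u p`, `u` is not constant, and all processes are about to access one object
(`exists_object`), in state `q₀` say. The value of `u` at a fixed process splits the processes into
two sides.

If sequences that start on opposite sides leave the object in the same state, a process outside both
cannot tell them apart (`not_sim`), so deleting any one process separates the two sets of states.
Likewise a sequence that restores `q₀` must contain the whole opposite side. Both sides cannot
restore `q₀`: two such sequences share a process other than `z`, whose step pays for a crash of `z`,
after which `z` cannot tell them apart (`not_same_memory`). `isRecording_of_sides` chooses the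
process to delete. -/

namespace ObjectType

/-! ### Combinatorics of the recording property -/

/-- The core of the combinatorial argument: removing the operation of index `r` from `m + 1`
operations that are split into two sides leaves `m` operations that witness recording. -/
theorem isRecording_of_remove {T : ObjectType.{uS, uO, uR}} {m : ℕ} (q₀ : T.State)
    (op : Fin (m + 1) → T.Op) (side : Fin (m + 1) → Bool) (r : Fin (m + 1))
    (hsame : ∃ j, j ≠ r ∧ side j = side r) (hother : ∃ i, side i ≠ side r)
    (hdisj : ∀ i l j l', side i ≠ side j → (i :: l).Nodup → (j :: l').Nodup → r ∉ i :: l →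
      r ∉ j :: l' → T.applySeq q₀ ((i :: l).map op) ≠ T.applySeq q₀ ((j :: l').map op))
    (hmiss : ∀ i l b, side i ≠ side b → (i :: l).Nodup → b ∉ i :: l →
      T.applySeq q₀ ((i :: l).map op) ≠ q₀)
    (hret : (∀ j l, side j = side r → (j :: l).Nodup → T.applySeq q₀ ((j :: l).map op) ≠ q₀) ∨
      ∃! i, side i ≠ side r) :
    T.IsRecording m := by
  have key : ∀ (X : Finset (Fin m)) (q : T.State), q ∈ T.Q X q₀ (op ∘ r.succAbove) →
      ∃ i l, (∃ a ∈ X, i = r.succAbove a) ∧ (i :: l).Nodup ∧ r ∉ i :: l ∧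
        T.applySeq q₀ ((i :: l).map op) = q := by
    rintro X q ⟨a, ha, l, hn, hq⟩
    refine ⟨r.succAbove a, l.map r.succAbove, ⟨a, ha, rfl⟩, ?_, ?_, ?_⟩
    · exact hn.map (Fin.succAbove_right_injective (p := r))
    · rw [← List.map_cons, List.mem_map]
      rintro ⟨x, -, hx⟩
      exact Fin.succAbove_ne r x hx
    · rw [← List.map_cons, List.map_map]
      exact hq
  refine ⟨q₀, Finset.univ.filter fun a => side (r.succAbove a) ≠ side r,
    Finset.univ.filter fun a => side (r.succAbove a) = side r, op ∘ r.succAbove, ?_, ?_, ?_, ?_,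
    ?_, ?_, ?_⟩
  · obtain ⟨i, hi⟩ := hother
    obtain ⟨a, rfl⟩ := Fin.exists_succAbove_eq (x := i) (y := r) (by rintro rfl; exact hi rfl)
    exact ⟨a, by simpa using hi⟩
  · obtain ⟨j, hj, hs⟩ := hsame
    obtain ⟨a, rfl⟩ := Fin.exists_succAbove_eq hj
    exact ⟨a, by simpa using hs⟩
  · rw [Finset.disjoint_left]
    intro a ha hb
    simp only [Finset.mem_filter] at ha hb
    exact ha.2 hb.2
  · ext a
    simp only [Finset.mem_union, Finset.mem_filter, Finset.mem_univ, true_and, iff_true]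
    exact ne_or_eq _ _
  · rw [Set.eq_empty_iff_forall_notMem]
    rintro q ⟨hA, hB⟩
    obtain ⟨i, l, ⟨a, ha, rfl⟩, hn, hr, hq⟩ := key _ _ hA
    obtain ⟨j, l', ⟨b, hb, rfl⟩, hn', hr', hq'⟩ := key _ _ hB
    simp only [Finset.mem_filter] at ha hb
    exact hdisj _ _ _ _ (by rw [hb.2]; exact ha.2) hn hn' hr hr' (hq.trans hq'.symm)
  · left
    intro hA
    obtain ⟨i, l, ⟨a, ha, rfl⟩, hn, hr, hq⟩ := key _ _ hA
    simp only [Finset.mem_filter] at ha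
    -- The deleted index itself is the missing member of the opposite side.
    exact hmiss _ _ r ha.2 hn hr hq
  · rcases hret with h | ⟨i, hi, huniq⟩
    · left
      intro hB
      obtain ⟨i, l, ⟨a, ha, rfl⟩, hn, hr, hq⟩ := key _ _ hB
      simp only [Finset.mem_filter] at ha
      exact h _ _ ha.2 hn hq
    · right
      obtain ⟨a, rfl⟩ := Fin.exists_succAbove_eq (x := i) (y := r) (by rintro rfl; exact hi rfl)
      rw [Finset.card_eq_one]
      refine ⟨a, ?_⟩
      ext b
      simp only [Finset.mem_filter, Finset.mem_univ, true_and, Finset.mem_singleton]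
      refine ⟨fun hb => Fin.succAbove_right_injective (p := r) (huniq _ hb), ?_⟩
      rintro rfl
      exact hi

/-- If one side is a singleton, an index of the other side is deleted, and the cardinality clause
excuses returns to `q₀`. Otherwise `hone` provides a side that never returns to `q₀`, and an index
of that side is deleted. Either way the reduced side stays non-empty. -/
theorem isRecording_of_sides {T : ObjectType.{uS, uO, uR}} {m : ℕ} (hm : 2 ≤ m) (q₀ : T.State)
    (op : Fin (m + 1) → T.Op) (side : Fin (m + 1) → Bool)
    (hboth : ∀ s, ∃ i, side i = s)
    (hdisj : ∀ r i l j l', side i ≠ side j → (i :: l).Nodup → (j :: l').Nodup → r ∉ i :: l →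
      r ∉ j :: l' → T.applySeq q₀ ((i :: l).map op) ≠ T.applySeq q₀ ((j :: l').map op))
    (hmiss : ∀ i l b, side i ≠ side b → (i :: l).Nodup → b ∉ i :: l →
      T.applySeq q₀ ((i :: l).map op) ≠ q₀)
    (hone : ∀ i l j l', side i ≠ side j → (i :: l).Nodup → (j :: l').Nodup →
      T.applySeq q₀ ((i :: l).map op) = q₀ → T.applySeq q₀ ((j :: l').map op) ≠ q₀) :
    T.IsRecording m := by
  by_cases hs : ∃ s, ∃! i, side i = s
  · obtain ⟨s, a, ha, huniq⟩ := hs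
    obtain ⟨r, hr⟩ := hboth (!s)
    have hside : ∀ i, i ≠ a → side i = !s := by
      intro i hi
      by_contra h
      exact hi (huniq i (by simpa using h))
    have hne : ∀ i, side i ≠ side r ↔ side i = s := by
      intro i; rw [hr]; cases side i <;> cases s <;> simp
    refine isRecording_of_remove q₀ op side r ?_ ⟨a, (hne a).2 ha⟩ (hdisj r) hmiss
      (Or.inr ⟨a, (hne a).2 ha, fun i hi => huniq i ((hne i).1 hi)⟩)
    -- There are `m + 1 ≥ 3` indices.
    have : ∃ j, j ∉ ({r, a} : Finset (Fin (m + 1))) := by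
      by_contra! h
      have h1 : Finset.univ ⊆ ({r, a} : Finset (Fin (m + 1))) := fun j _ => h j
      have h2 := Finset.card_le_card h1
      have h3 := Finset.card_le_two (a := r) (b := a)
      simp at h2
      omega
    obtain ⟨j, hj⟩ := this
    simp only [Finset.mem_insert, Finset.mem_singleton, not_or] at hj
    exact ⟨j, hj.1, by rw [hside j hj.2, hr]⟩
  · have main : ∀ s, (∀ j l, side j = s → (j :: l).Nodup →
        T.applySeq q₀ ((j :: l).map op) ≠ q₀) → T.IsRecording m := by
      intro s h
      obtain ⟨r, hr⟩ := hboth s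
      obtain ⟨a, ha⟩ := hboth (!s)
      refine isRecording_of_remove q₀ op side r ?_ ⟨a, by rw [ha, hr]; cases s <;> simp⟩ (hdisj r)
        hmiss (Or.inl fun j l hj => h j l (hj.trans hr))
      by_contra! hc
      exact hs ⟨s, r, hr, fun j hj => by
        by_contra hjr
        exact hc j hjr (hj.trans hr.symm)⟩
    by_cases h : ∀ j l, side j = true → (j :: l).Nodup → T.applySeq q₀ ((j :: l).map op) ≠ q₀
    · exact main true h
    · push Not at h
      obtain ⟨j, l, hj, hn, hq⟩ := h
      exact main false fun i l' hi hn' => hone j l i l' (by rw [hj, hi]; simp) hn hn' hq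

end ObjectType

/-! ### Finite runs and indistinguishability -/

namespace Algorithm

variable {T : ObjectType.{uS, uO, uR}} {n : ℕ} {V : Type uV}
variable (A : Algorithm.{uS, uO, uR, uV, uX, uG, uD, uL} T n V)

/-- The configuration reached from `c` by a finite schedule. -/
noncomputable def run (input : Fin n → V) (c : A.Config) (l : List (Event n)) : A.Config :=
  l.foldl (A.exec input) c

@[simp] theorem run_nil (input : Fin n → V) (c : A.Config) : A.run input c [] = c := rfl

@[simp] theorem run_cons (input : Fin n → V) (c : A.Config) (e : Event n) (l : List (Event n)) :
    A.run input c (e :: l) = A.run input (A.exec input c e) l := rfl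

theorem run_append (input : Fin n → V) (c : A.Config) (l l' : List (Event n)) :
    A.run input c (l ++ l') = A.run input (A.run input c l) l' := List.foldl_append

/-- The configurations that occur in executions with the given inputs. -/
def Reachable (input : Fin n → V) (c : A.Config) : Prop :=
  ∃ l, A.run input (A.initial input) l = c

variable {A} {input : Fin n → V} {c : A.Config}

theorem Reachable.initial : A.Reachable input (A.initial input) := ⟨[], rfl⟩

theorem Reachable.run (h : A.Reachable input c) (l : List (Event n)) :
    A.Reachable input (A.run input c l) := by
  obtain ⟨l₀, rfl⟩ := h
  exact ⟨l₀ ++ l, A.run_append ..⟩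

theorem Reachable.exec (h : A.Reachable input c) (e : Event n) :
    A.Reachable input (A.exec input c e) := h.run [e]

/-- Process `p` outputs `v` in configuration `c`. -/
def OutputsAt (c : A.Config) (p : Fin n) (v : V) : Prop := A.code p (c.loc p) = .output v

/-- The infinite schedule that continues a finite one by steps of process `p` only. -/
def extend (l : List (Event n)) (p : Fin n) (s : ℕ) : Event n := l.getD s (.step p)

theorem config_extend (l : List (Event n)) (p : Fin n) {s : ℕ} (hs : s ≤ l.length) :
    A.config input (extend l p) s = A.run input (A.initial input) (l.take s) := by
  induction s with
  | zero => rfl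
  | succ s ih =>
    rw [config, ih (by omega), List.take_add_one, run_append]
    have h : l[s]? = some l[s] := List.getElem?_eq_getElem hs
    simp [extend, h]

theorem config_extend_add (l : List (Event n)) (p : Fin n) (k : ℕ) :
    A.config input (extend l p) (l.length + k) =
      A.run input (A.run input (A.initial input) l) (List.replicate k (.step p)) := by
  induction k with
  | zero => simpa using config_extend l p le_rfl
  | succ k ih =>
    rw [← add_assoc, config, ih, List.replicate_succ', run_append]
    simp [extend]

theorem Agreement.outputsAt_eq (h : A.Agreement) (hc : A.Reachable input c) {l : List (Event n)}
    {p q : Fin n} {v w : V} (hv : A.OutputsAt c p v)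
    (hw : A.OutputsAt (A.run input c l) q w) : v = w := by
  obtain ⟨l₀, rfl⟩ := hc
  refine h input (extend (l₀ ++ l) p) l₀.length (l₀ ++ l).length p q v w ?_ ?_
  · rw [Outputs, config_extend _ _ (by simp)]
    simpa [OutputsAt] using hv
  · rw [Outputs, config_extend _ _ le_rfl, List.take_length, run_append]
    exact hw

theorem RecoverableWaitFree.exists_solo (h : A.RecoverableWaitFree) (hc : A.Reachable input c)
    (p : Fin n) : ∃ k v, A.OutputsAt (A.run input c (List.replicate k (.step p))) p v := by
  obtain ⟨l, rfl⟩ := hc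
  have hstep : ∀ s ≥ l.length, extend l p s = .step p := fun s hs => by simp [extend, hs]
  obtain ⟨s, hs, v, hv⟩ := h input (extend l p) p l.length
    (fun s hs => by rw [hstep s hs]; simp)
    (Filter.frequently_atTop.2 fun a => ⟨max a l.length, le_max_left _ _, hstep _ (le_max_right _ _)⟩)
  obtain ⟨k, rfl⟩ := Nat.exists_eq_add_of_le hs
  refine ⟨k, v, ?_⟩
  rw [Outputs, config_extend_add] at hv
  exact hv

/-- Process `p` cannot distinguish the two configurations by taking steps alone. -/
structure Sim (p : Fin n) (c c' : A.Config) : Prop where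
  obj : c.obj = c'.obj
  reg : c.reg = c'.reg
  loc : c.loc p = c'.loc p

theorem Sim.step {p : Fin n} {c c' : A.Config} (h : Sim p c c') (input input' : Fin n → V) :
    Sim p (A.exec input c (.step p)) (A.exec input' c' (.step p)) := by
  obtain ⟨h1, h2, h3⟩ := h
  cases hcode : A.code p (c'.loc p) <;>
    constructor <;> simp [Algorithm.exec, h1, h2, h3, hcode]

theorem Sim.solo {p : Fin n} {c c' : A.Config} (h : Sim p c c') (input input' : Fin n → V) (k : ℕ) :
    Sim p (A.run input c (List.replicate k (.step p)))
      (A.run input' c' (List.replicate k (.step p))) := by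
  induction k generalizing c c' with
  | zero => exact h
  | succ k ih =>
    rw [List.replicate_succ]
    exact ih (h.step input input')

/-! ### Crash budgets and valency -/

/-- The finite schedules in which only `z` crashes, where every crash uses up a credit, `k` credits
are available at the beginning and every step of another process provides one. -/
def Legal (z : Fin n) : ℕ → List (Event n) → Prop
  | _, [] => True
  | k, .step p :: l => Legal z (if p = z then k else k + 1) l
  | k, .crash p :: l => p = z ∧ ∃ k', k = k' + 1 ∧ Legal z k' l

theorem Legal.mono {z : Fin n} {k k' : ℕ} {l : List (Event n)} (h : Legal z k l) (hk : k ≤ k') :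
    Legal z k' l := by
  induction l generalizing k k' with
  | nil => trivial
  | cons e l ih =>
    cases e with
    | step p =>
      refine ih (k := if p = z then k else k + 1) h ?_
      split_ifs <;> omega
    | crash p =>
      obtain ⟨rfl, j, rfl, hj⟩ := h
      exact ⟨rfl, k' - 1, by omega, ih hj (by omega)⟩

theorem Legal.steps_append {z : Fin n} {k : ℕ} {l : List (Event n)} (h : Legal z k l)
    (s : List (Fin n)) : Legal z k (s.map .step ++ l) := by
  induction s with
  | nil => exact h
  | cons p s ih =>
    exact Legal.mono (k' := if p = z then k else k + 1) ih (by split_ifs <;> omega)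

theorem Legal.steps_append_of_mem {z : Fin n} {k : ℕ} {l : List (Event n)}
    (h : Legal z (k + 1) l) {s : List (Fin n)} {p : Fin n} (hp : p ∈ s) (hpz : p ≠ z) :
    Legal z k (s.map .step ++ l) := by
  induction s with
  | nil => simp at hp
  | cons q s ih =>
    rcases List.mem_cons.1 hp with rfl | hp
    · have := h.steps_append s
      simpa [Legal, hpz] using this
    · exact Legal.mono (k' := if q = z then k else k + 1) (ih hp) (by split_ifs <;> omega)

/-- The value `v` is output in some legal continuation. -/
def CanOutput (input : Fin n → V) (z : Fin n) (k : ℕ) (c : A.Config) (v : V) : Prop :=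
  ∃ l, Legal z k l ∧ ∃ p, A.OutputsAt (A.run input c l) p v

/-- At most one value can be output in legal continuations. -/
def Univalent (input : Fin n → V) (z : Fin n) (k : ℕ) (c : A.Config) : Prop :=
  ∀ v w, CanOutput input z k c v → CanOutput input z k c w → v = w

variable {z : Fin n} {k : ℕ}

theorem CanOutput.mono {k' : ℕ} {v : V} (h : CanOutput input z k c v) (hk : k ≤ k') :
    CanOutput input z k' c v := by
  obtain ⟨l, hl, h⟩ := h
  exact ⟨l, hl.mono hk, h⟩

theorem CanOutput.of_steps {v : V} (s : List (Fin n))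
    (h : CanOutput input z k (A.run input c (s.map .step)) v) : CanOutput input z k c v := by
  obtain ⟨l, hl, p, h⟩ := h
  exact ⟨s.map .step ++ l, hl.steps_append s, p, by rwa [run_append]⟩

theorem CanOutput.of_steps_of_mem {v : V} {s : List (Fin n)} {p : Fin n}
    (h : CanOutput input z (k + 1) (A.run input c (s.map .step)) v) (hp : p ∈ s) (hpz : p ≠ z) :
    CanOutput input z k c v := by
  obtain ⟨l, hl, q, h⟩ := h
  exact ⟨s.map .step ++ l, hl.steps_append_of_mem hp hpz, q, by rwa [run_append]⟩

theorem CanOutput.of_crash {v : V} (h : CanOutput input z k (A.exec input c (.crash z)) v) :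
    CanOutput input z (k + 1) c v := by
  obtain ⟨l, hl, q, h⟩ := h
  exact ⟨.crash z :: l, ⟨rfl, k, rfl, hl⟩, q, h⟩

theorem canOutput_solo {p : Fin n} {v : V} {j : ℕ}
    (h : A.OutputsAt (A.run input c (List.replicate j (.step p))) p v) :
    CanOutput input z k c v := by
  refine ⟨List.replicate j (.step p), ?_, p, h⟩
  have := Legal.steps_append (z := z) (k := k) (l := []) trivial (List.replicate j p)
  simpa using this

/-- The solo run of `p` is the same from both configurations and needs no credit. -/
theorem RecoverableWaitFree.exists_common (h : A.RecoverableWaitFree) {c' : A.Config}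
    (hc : A.Reachable input c) {p : Fin n} (hs : Sim p c c') (z : Fin n) :
    ∃ v, CanOutput input z 0 c v ∧ CanOutput input z 0 c' v := by
  obtain ⟨j, v, hv⟩ := h.exists_solo hc p
  refine ⟨v, canOutput_solo hv, canOutput_solo (p := p) (j := j) ?_⟩
  rw [OutputsAt, ← (hs.solo input input j).loc]
  exact hv

/-! ### Bivalence and critical configurations -/

/-- Credits left after an event. -/
def credit (z : Fin n) (k : ℕ) : Event n → ℕ
  | .step p => if p = z then k else k + 1
  | .crash _ => k - 1

/-- The events that are allowed when `k` credits are available. -/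
def Allowed (z : Fin n) (k : ℕ) : Event n → Prop
  | .step _ => True
  | .crash p => p = z ∧ 0 < k

theorem Agreement.not_outputsAt (h : A.Agreement) (hc : A.Reachable input c)
    (hb : ¬ Univalent input z k c) (p : Fin n) (v : V) : ¬ A.OutputsAt c p v := by
  intro hv
  refine hb ?_
  rintro x y ⟨l, -, q, hx⟩ ⟨l', -, q', hy⟩
  exact (h.outputsAt_eq hc hv hx).symm.trans (h.outputsAt_eq hc hv hy)

/-- No infinite schedule of allowed events avoids all outputs. -/
theorem RecoverableWaitFree.exists_outputs (h : A.RecoverableWaitFree) (σ : ℕ → Event n)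
    (κ : ℕ → ℕ) (hκ : ∀ t, κ (t + 1) = credit z (κ t) (σ t)) (hσ : ∀ t, Allowed z (κ t) (σ t)) :
    ∃ t p v, A.OutputsAt (A.config input σ t) p v := by
  by_cases hinf : ∃ p ≠ z, ∃ᶠ s in atTop, σ s = .step p
  · obtain ⟨p, hp, hfreq⟩ := hinf
    obtain ⟨s, -, v, hv⟩ := h input σ p 0 (fun s _ hs => by
      have := hσ s
      rw [hs] at this
      exact hp this.1) hfreq
    exact ⟨s, p, v, hv⟩
  · have hev : ∀ᶠ s in atTop, ∀ p ≠ z, σ s ≠ .step p := by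
      rw [Filter.eventually_all]
      intro p
      by_cases hp : p = z
      · exact Filter.Eventually.of_forall fun s h => absurd hp h
      · have : ∀ᶠ s in atTop, σ s ≠ .step p := by
          rw [← Filter.not_frequently]
          exact fun hf => hinf ⟨p, hp, hf⟩
        exact this.mono fun s hs _ => hs
    obtain ⟨t₀, ht₀⟩ := Filter.eventually_atTop.1 hev
    have hcase : ∀ s ≥ t₀, σ s = .step z ∨ (σ s = .crash z ∧ κ (s + 1) < κ s) := by
      intro s hs
      have h1 := hσ s
      have h2 := hκ s
      cases he : σ s with
      | step p =>
        left
        by_contra hp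
        exact ht₀ s hs p (fun h => hp (by rw [h])) he
      | crash p =>
        rw [he] at h1 h2
        obtain ⟨rfl, hpos⟩ := h1
        refine Or.inr ⟨rfl, ?_⟩
        simp only [credit] at h2
        omega
    -- From `t₀` on only `z` acts, so credits never increase; after their minimum is attained no
    -- crash can occur.
    obtain ⟨t₁, ht₁, hmin⟩ := (measure κ).wf.has_min {s | t₀ ≤ s} ⟨t₀, le_refl t₀⟩
    have hstep : ∀ s, κ (t₁ + s) = κ t₁ ∧ σ (t₁ + s) = .step z := by
      have hz : ∀ s, κ (t₁ + s) = κ t₁ → σ (t₁ + s) = .step z := fun s hs => by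
        have hge : t₀ ≤ t₁ + s := le_add_right ht₁
        refine (hcase _ hge).resolve_right fun hc => ?_
        exact hmin (t₁ + s + 1) (hge.trans (Nat.le_succ _)) (hc.2.trans_eq hs)
      intro s
      induction s with
      | zero => exact ⟨rfl, hz 0 rfl⟩
      | succ s ih =>
        have hk : κ (t₁ + (s + 1)) = κ t₁ := by
          rw [← add_assoc, hκ, ih.2]
          simpa [credit] using ih.1
        exact ⟨hk, hz _ hk⟩
    have hstep' : ∀ s ≥ t₁, σ s = .step z := fun s hs => by
      obtain ⟨j, rfl⟩ := Nat.exists_eq_add_of_le hs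
      exact (hstep j).2
    obtain ⟨s, -, v, hv⟩ := h input σ z t₁ (fun s hs => by rw [hstep' s hs]; simp)
      (Filter.frequently_atTop.2 fun a =>
        ⟨max a t₁, le_max_left _ _, hstep' _ (le_max_right _ _)⟩)
    exact ⟨s, z, v, hv⟩

/-- A critical configuration: it is not univalent, but every allowed event makes it so. -/
structure Critical (input : Fin n → V) (z : Fin n) (k : ℕ) (c : A.Config) : Prop where
  reachable : A.Reachable input c
  not_univalent : ¬ Univalent input z k c
  univalent : ∀ e, Allowed z k e → Univalent input z (credit z k e) (A.exec input c e)

/-- Otherwise a non-univalent configuration always has a non-univalent allowed successor. The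
resulting infinite schedule must reach an output, yet by agreement a configuration with an output is
univalent. -/
theorem exists_critical (hag : A.Agreement) (hwf : A.RecoverableWaitFree)
    (hb : ¬ Univalent input z k (A.initial input)) : ∃ k c, Critical (A := A) input z k c := by
  by_contra! hno
  have hnext : ∀ x : {x : A.Config × ℕ // A.Reachable input x.1 ∧ ¬ Univalent input z x.2 x.1},
      ∃ e, Allowed z x.1.2 e ∧ ¬ Univalent input z (credit z x.1.2 e) (A.exec input x.1.1 e) := by
    rintro ⟨⟨c, k⟩, hr, hb⟩
    by_contra! h
    exact hno k c ⟨hr, hb, h⟩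
  choose e hall hbiv using hnext
  let next (x : {x : A.Config × ℕ // A.Reachable input x.1 ∧ ¬ Univalent input z x.2 x.1}) :
      {x : A.Config × ℕ // A.Reachable input x.1 ∧ ¬ Univalent input z x.2 x.1} :=
    ⟨(A.exec input x.1.1 (e x), credit z x.1.2 (e x)), x.2.1.exec _, hbiv x⟩
  let path (t : ℕ) := next^[t] ⟨(A.initial input, k), Reachable.initial, hb⟩
  have hpath : ∀ t, path (t + 1) = next (path t) := fun t => Function.iterate_succ_apply' ..
  have hconfig : ∀ t, A.config input (fun t => e (path t)) t = (path t).1.1 := by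
    intro t
    induction t with
    | zero => rfl
    | succ t ih => rw [config, ih, hpath]
  obtain ⟨t, p, v, hv⟩ := hwf.exists_outputs (input := input) (fun t => e (path t))
    (fun t => (path t).1.2) (fun t => by rw [hpath]) (fun t => hall _)
  rw [hconfig] at hv
  exact hag.not_outputsAt (path t).2.1 (path t).2.2 p v hv

/-- Running alone, `p` cannot tell these inputs from the constant assignment `input p`, where
validity fixes its output. -/
theorem canOutput_input (hA : A.SolvesRC) (p z : Fin n) :
    CanOutput input z 0 (A.initial input) (input p) := by
  obtain ⟨-, hval, hwf⟩ := hA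
  obtain ⟨j, v, hv⟩ := hwf.exists_solo (Reachable.initial (A := A) (input := fun _ => input p)) p
  have hv' : v = input p := by
    obtain ⟨q, hq⟩ := hval (fun _ => input p) (extend [] p) ([].length + j) p v
      (by rw [Outputs, config_extend_add]; exact hv)
    exact hq.symm
  subst hv'
  refine canOutput_solo (p := p) (j := j) ?_
  have hs : Sim p (A.initial fun _ => input p) (A.initial input) := ⟨rfl, rfl, rfl⟩
  rw [OutputsAt, ← (hs.solo (fun _ => input p) input j).loc]
  exact hv

/-! ### Structure of a critical configuration -/

/-- The effect of steps of distinct processes that are about to access the same object. -/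
theorem run_poised {o : A.Obj} {op : Fin n → T.Op} {s : List (Fin n)} (hs : s.Nodup)
    (hc : ∀ p ∈ s, ∃ f, A.code p (c.loc p) = .access o (op p) f) :
    (A.run input c (s.map .step)).obj o = T.applySeq (c.obj o) (s.map op) ∧
    (∀ o' ≠ o, (A.run input c (s.map .step)).obj o' = c.obj o') ∧
    (A.run input c (s.map .step)).reg = c.reg ∧
    ∀ p ∉ s, (A.run input c (s.map .step)).loc p = c.loc p := by
  induction s generalizing c with
  | nil => simp [ObjectType.applySeq]
  | cons q s ih =>
    obtain ⟨hq, hs⟩ := List.nodup_cons.1 hs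
    obtain ⟨f, hf⟩ := hc q List.mem_cons_self
    have hloc : ∀ p ≠ q, (A.exec input c (.step q)).loc p = c.loc p := fun p hp => by
      simp [Algorithm.exec, hf, hp]
    obtain ⟨h1, h2, h3, h4⟩ := ih (c := A.exec input c (.step q)) hs fun p hp => by
      rw [hloc p (by rintro rfl; exact hq hp)]
      exact hc p (List.mem_cons_of_mem _ hp)
    rw [List.map_cons, run_cons]
    refine ⟨?_, fun o' ho => ?_, ?_, fun p hp => ?_⟩
    · rw [h1]
      simp [Algorithm.exec, hf, ObjectType.applySeq]
    · rw [h2 o' ho]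
      simp [Algorithm.exec, hf, ho]
    · rw [h3]
      simp [Algorithm.exec, hf]
    · rw [List.mem_cons, not_or] at hp
      rw [h4 p hp.2, hloc p hp.1]

namespace Critical

theorem exists_decision (h : Critical input z k c) (hwf : A.RecoverableWaitFree) :
    ∃ u : Fin n → V, ∀ p v,
      CanOutput input z (credit z k (.step p)) (A.exec input c (.step p)) v → v = u p := by
  have : ∀ p, ∃ u, ∀ v,
      CanOutput input z (credit z k (.step p)) (A.exec input c (.step p)) v → v = u := fun p => by
    obtain ⟨u, hu, -⟩ := hwf.exists_common (h.reachable.exec (.step p))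
      (⟨rfl, rfl, rfl⟩ : Sim p _ _) z
    exact ⟨u, fun v hv => h.univalent (.step p) trivial v u hv (hu.mono (Nat.zero_le _))⟩
  exact ⟨fun p => (this p).choose, fun p => (this p).choose_spec⟩

variable {u : Fin n → V}

/-- Only a crash of `z` as first event needs an argument: `q` does not notice it, so a solo run of
`q` ties the decision after the crash to `u q`. -/
theorem exists_decision_eq (h : Critical input z k c) (hag : A.Agreement)
    (hwf : A.RecoverableWaitFree)
    (hu : ∀ p v,
      CanOutput input z (credit z k (.step p)) (A.exec input c (.step p)) v → v = u p)
    {q : Fin n} (hq : q ≠ z) {v : V} (hv : CanOutput input z k c v) : ∃ p, u p = v := by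
  obtain ⟨l, hl, p, hp⟩ := hv
  cases l with
  | nil => exact absurd hp (hag.not_outputsAt h.reachable h.not_univalent p v)
  | cons e l =>
    cases e with
    | step p' => exact ⟨p', (hu p' v ⟨l, hl, p, hp⟩).symm⟩
    | crash p' =>
      obtain ⟨rfl, k', rfl, hl⟩ := hl
      have hs : Sim q c (A.exec input c (.crash p')) :=
        ⟨rfl, rfl, by simp [Algorithm.exec, hq]⟩
      obtain ⟨x, hx, hx'⟩ := hwf.exists_common (h.reachable.exec (.step q))
        (hs.step input input) p'
      have h1 := hu q x (hx.mono (Nat.zero_le _))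
      have h2 : CanOutput input p' k' (A.exec input c (.crash p')) x :=
        (CanOutput.of_steps [q] hx').mono (Nat.zero_le _)
      have h3 := h.univalent (.crash p') ⟨rfl, Nat.succ_pos _⟩ v x ⟨l, hl, p, hp⟩ h2
      exact ⟨q, by rw [← h1, h3]⟩

theorem decision_eq
    (hu : ∀ p v,
      CanOutput input z (credit z k (.step p)) (A.exec input c (.step p)) v → v = u p)
    {i : Fin n} {s : List (Fin n)} {v : V}
    (hv : CanOutput input z 0 (A.run input c ((i :: s).map .step)) v) : v = u i :=
  hu i v ((CanOutput.of_steps s hv).mono (Nat.zero_le _))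

/-- The step of `p` earns the one credit available after the run, even if `k = 0`. -/
theorem decision_eq_of_mem
    (hu : ∀ p v,
      CanOutput input z (credit z k (.step p)) (A.exec input c (.step p)) v → v = u p)
    {i p : Fin n} {s : List (Fin n)} {v : V} (hp : p ∈ i :: s) (hpz : p ≠ z)
    (hv : CanOutput input z 1 (A.run input c ((i :: s).map .step)) v) : v = u i := by
  refine hu i v ?_
  by_cases hi : i = z
  · subst hi
    have hps := (List.mem_cons.1 hp).resolve_left hpz
    exact (CanOutput.of_steps_of_mem (c := A.exec input c (.step i)) (s := s) hv hps hpz).mono (Nat.zero_le _)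
  · exact (CanOutput.of_steps s hv).mono (by simp [credit, hi])

theorem not_sim (h : Critical input z k c) (hwf : A.RecoverableWaitFree)
    (hu : ∀ p v,
      CanOutput input z (credit z k (.step p)) (A.exec input c (.step p)) v → v = u p)
    {i j : Fin n} (hij : u i ≠ u j) (s s' : List (Fin n)) (p : Fin n) :
    ¬ Sim p (A.run input c ((i :: s).map .step)) (A.run input c ((j :: s').map .step)) := by
  intro hs
  obtain ⟨x, hx, hx'⟩ := hwf.exists_common (h.reachable.run _) hs z
  exact hij ((decision_eq hu hx).symm.trans (decision_eq hu hx'))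

/-- If both schedules contain a step of a process other than `z`, they do not lead to the same
shared memory: otherwise `z` could crash and run alone. -/
theorem not_same_memory (h : Critical input z k c) (hwf : A.RecoverableWaitFree)
    (hu : ∀ p v,
      CanOutput input z (credit z k (.step p)) (A.exec input c (.step p)) v → v = u p)
    {i j : Fin n} (hij : u i ≠ u j) {s s' : List (Fin n)} {p q : Fin n} (hp : p ∈ i :: s)
    (hpz : p ≠ z) (hq : q ∈ j :: s') (hqz : q ≠ z)
    (hobj : (A.run input c ((i :: s).map .step)).obj = (A.run input c ((j :: s').map .step)).obj)
    (hreg : (A.run input c ((i :: s).map .step)).reg =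
      (A.run input c ((j :: s').map .step)).reg) : False := by
  have hs : Sim z (A.exec input (A.run input c ((i :: s).map .step)) (.crash z))
      (A.exec input (A.run input c ((j :: s').map .step)) (.crash z)) :=
    ⟨hobj, hreg, by simp [Algorithm.exec]⟩
  obtain ⟨x, hx, hx'⟩ := hwf.exists_common ((h.reachable.run _).exec _) hs z
  exact hij ((decision_eq_of_mem hu hp hpz hx.of_crash).symm.trans
    (decision_eq_of_mem hu hq hqz hx'.of_crash))

/-- Two processes whose steps lead to different decisions access the same object. -/
theorem same_object (h : Critical input z k c) (hag : A.Agreement) (hwf : A.RecoverableWaitFree)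
    (hu : ∀ p v,
      CanOutput input z (credit z k (.step p)) (A.exec input c (.step p)) v → v = u p)
    {i j : Fin n} (hij : u i ≠ u j) :
    ∃ o x f y g, A.code i (c.loc i) = .access o x f ∧ A.code j (c.loc j) = .access o y g := by
  classical
  have hne : i ≠ j := by rintro rfl; exact hij rfl
  have hne' : j ≠ i := hne.symm
  have hno := hag.not_outputsAt h.reachable h.not_univalent
  -- The three excluded patterns: the steps commute; the step of `i` is invisible to `j` or
  -- overwritten by it; the step of `j` is invisible to `i`.
  have hcomm := h.not_sim hwf hu hij [j] [i] i
  have hleft := h.not_sim hwf hu hij [j] [] j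
  have hright := h.not_sim hwf hu hij [] [i] i
  rcases hi : A.code i (c.loc i) with ⟨o, x, f⟩ | ⟨r, f⟩ | ⟨r, x, f⟩ | v
  · rcases hj : A.code j (c.loc j) with ⟨o', y, g⟩ | ⟨r, g⟩ | ⟨r, y, g⟩ | v
    · by_cases ho : o = o'
      · subst ho
        exact ⟨o, x, f, y, g, rfl, rfl⟩
      · refine absurd ⟨?_, ?_, ?_⟩ hcomm <;>
          simp [Algorithm.exec, hi, hj, hne, hne', ho, Ne.symm ho, Function.update_comm ho]
    · refine absurd ⟨?_, ?_, ?_⟩ hright <;> simp [Algorithm.exec, hi, hj, hne]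
    · refine absurd ⟨?_, ?_, ?_⟩ hcomm <;> simp [Algorithm.exec, hi, hj, hne, hne']
    · exact absurd hj (hno j v)
  · refine absurd ⟨?_, ?_, ?_⟩ hleft <;>
      cases hj : A.code j (c.loc j) <;> simp [Algorithm.exec, hi, hj, hne']
  · rcases hj : A.code j (c.loc j) with ⟨o', y, g⟩ | ⟨r', g⟩ | ⟨r', y, g⟩ | v
    · refine absurd ⟨?_, ?_, ?_⟩ hcomm <;> simp [Algorithm.exec, hi, hj, hne, hne']
    · refine absurd ⟨?_, ?_, ?_⟩ hright <;> simp [Algorithm.exec, hi, hj, hne]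
    · by_cases hr : r = r'
      · subst hr
        refine absurd ⟨?_, ?_, ?_⟩ hleft <;> simp [Algorithm.exec, hi, hj, hne']
      · refine absurd ⟨?_, ?_, ?_⟩ hcomm <;>
          simp [Algorithm.exec, hi, hj, hne, hne', Function.update_comm hr]
    · exact absurd hj (hno j v)
  · exact absurd hi (hno i v)

/-- Every process disagrees with `i` or with `j`, hence shares the object that these two access. -/
theorem exists_object (h : Critical input z k c) (hag : A.Agreement) (hwf : A.RecoverableWaitFree)
    (hu : ∀ p v,
      CanOutput input z (credit z k (.step p)) (A.exec input c (.step p)) v → v = u p)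
    {i j : Fin n} (hij : u i ≠ u j) :
    ∃ o, ∃ op : Fin n → T.Op, ∀ p, ∃ f, A.code p (c.loc p) = .access o (op p) f := by
  obtain ⟨o, x, f, y, g, hi, hj⟩ := h.same_object hag hwf hu hij
  have : ∀ p, ∃ a f, A.code p (c.loc p) = .access o a f := by
    intro p
    by_cases hp : u p = u i
    · obtain ⟨o', x', f', y', g', hp', hj'⟩ := h.same_object hag hwf hu (hp ▸ hij : u p ≠ u j)
      rw [hj] at hj'
      cases hj'
      exact ⟨x', f', hp'⟩
    · obtain ⟨o', x', f', y', g', hp', hi'⟩ := h.same_object hag hwf hu hp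
      rw [hi] at hi'
      cases hi'
      exact ⟨x', f', hp'⟩
  choose op hop using this
  exact ⟨o, op, hop⟩

end Critical

/-! ### From a critical configuration to recording -/

theorem SolvesRC.isRecording {m : ℕ} (hm : 2 ≤ m) [Nontrivial V]
    {A : Algorithm.{uS, uO, uR, uV, uX, uG, uD, uL} T (m + 1) V} (hA : A.SolvesRC) :
    T.IsRecording m := by
  classical
  have hA' := hA
  obtain ⟨hag, -, hwf⟩ := hA'
  obtain ⟨v, w, hvw⟩ := exists_pair_ne V
  have h0 : (0 : Fin (m + 1)) ≠ Fin.last m := by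
    rw [Ne, Fin.ext_iff, Fin.val_last, Fin.val_zero]
    omega
  let z := Fin.last m
  let input : Fin (m + 1) → V := fun p => if p = z then w else v
  have hb : ¬ Univalent input z 0 (A.initial input) := fun h => by
    have hv := canOutput_input (input := input) hA 0 z
    have hw := canOutput_input (input := input) hA z z
    have := h _ _ hv hw
    simp only [input, z, h0, if_true, if_false] at this
    exact hvw this
  obtain ⟨k, c, h⟩ := exists_critical hag hwf hb
  obtain ⟨u, hu⟩ := h.exists_decision hwf
  obtain ⟨i₀, j₀, hij⟩ : ∃ i j, u i ≠ u j := by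
    by_contra! hall
    refine h.not_univalent fun x y hx hy => ?_
    obtain ⟨p, rfl⟩ := h.exists_decision_eq hag hwf hu h0 hx
    obtain ⟨q, rfl⟩ := h.exists_decision_eq hag hwf hu h0 hy
    exact hall p q
  obtain ⟨o, op, hop⟩ := h.exists_object hag hwf hu hij
  have hrun := fun (s : List (Fin (m + 1))) (hs : s.Nodup) =>
    run_poised (input := input) hs fun p _ => hop p
  have hobj : ∀ s s' : List (Fin (m + 1)), s.Nodup → s'.Nodup →
      T.applySeq (c.obj o) (s.map op) = T.applySeq (c.obj o) (s'.map op) →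
      (A.run input c (s.map .step)).obj = (A.run input c (s'.map .step)).obj := by
    intro s s' hs hs' heq
    funext o'
    by_cases ho : o' = o
    · subst ho
      rw [(hrun s hs).1, (hrun s' hs').1, heq]
    · rw [(hrun s hs).2.1 o' ho, (hrun s' hs').2.1 o' ho]
  have hreg : ∀ s s' : List (Fin (m + 1)), s.Nodup → s'.Nodup →
      (A.run input c (s.map .step)).reg = (A.run input c (s'.map .step)).reg :=
    fun s s' hs hs' => (hrun s hs).2.2.1.trans (hrun s' hs').2.2.1.symm
  have hside : ∀ i j, decide (u i = u i₀) ≠ decide (u j = u i₀) → u i ≠ u j := by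
    intro i j hne heq
    exact hne (by rw [heq])
  have hmiss : ∀ i l b, decide (u i = u i₀) ≠ decide (u b = u i₀) → (i :: l).Nodup →
      b ∉ i :: l → T.applySeq (c.obj o) ((i :: l).map op) ≠ c.obj o := by
    intro i l b hib hn hbl heq
    have hn' : ((i :: l) ++ [b]).Nodup :=
      hn.append (List.nodup_singleton b) (by simpa [List.disjoint_singleton] using hbl)
    have hs : Sim b (A.run input c ((i :: l).map .step)) c := by
      refine ⟨hobj (i :: l) [] hn List.nodup_nil heq, (hrun _ hn).2.2.1, (hrun _ hn).2.2.2 b hbl⟩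
    -- Since `b` sees no difference from `c`, its step after `i :: l` looks to it like its step from
    -- `c`, where it would be the first to move.
    refine h.not_sim hwf hu (hside i b hib) (l ++ [b]) [] b ?_
    have := hs.step input input
    rw [← List.cons_append, List.map_append, run_append]
    exact this
  refine ObjectType.isRecording_of_sides hm (c.obj o) op (fun p => decide (u p = u i₀)) ?_ ?_
    hmiss ?_
  · rintro (_ | _)
    · exact ⟨j₀, by simpa using hij.symm⟩
    · exact ⟨i₀, by simp⟩
  · intro r i l j l' hij hn hn' hr hr' heq
    exact h.not_sim hwf hu (hside i j hij) l l' r ⟨hobj _ _ hn hn' heq, hreg _ _ hn hn',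
      ((hrun _ hn).2.2.2 r hr).trans ((hrun _ hn').2.2.2 r hr').symm⟩
  · intro i l j l' hij hn hn' heq heq'
    have hj : j ∈ i :: l := by
      by_contra hj
      exact hmiss i l j hij hn hj heq
    have hi : i ∈ j :: l' := by
      by_contra hi
      exact hmiss j l' i hij.symm hn' hi heq'
    have hne : i ≠ j := by rintro rfl; exact hij rfl
    -- By `hmiss` both sequences contain both `i` and `j`, and at most one of these is `z`.
    obtain ⟨p, hp, hp', hpz⟩ : ∃ p, p ∈ i :: l ∧ p ∈ j :: l' ∧ p ≠ z := by
      by_cases hiz : i = z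
      · exact ⟨j, hj, List.mem_cons_self, fun h => hne (hiz.trans h.symm)⟩
      · exact ⟨i, List.mem_cons_self, hi, hiz⟩
    exact h.not_same_memory hwf hu (hside i j hij) hp hpz hp' hpz
      (hobj _ _ hn hn' (heq.trans heq'.symm)) (hreg _ _ hn hn')

end Algorithm

theorem theorem3 {T : ObjectType.{uS, uO, uR}} {n : ℕ} (hn : 3 ≤ n)
    {V : Type uV} [Nontrivial V]
    (A : Algorithm.{uS, uO, uR, uV, uX, uG, uD, uL} T n V) (hA : A.SolvesRC) :
    T.IsRecording (n - 1) := by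
  obtain ⟨m, rfl⟩ := Nat.exists_eq_add_of_le' (show 1 ≤ n by omega)
  exact Algorithm.SolvesRC.isRecording (by omega) hA
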